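/- Let $\hbar>0$ and let $\mu$ be a Borel probability measure on $\mathbb R$ (the law of a random momentum kick; for instance $d\mu(p)=\tilde g(p)\,dp$ with a probability density $\tilde g$). Let $\hat X$ be the position operator on $L^2(\mathbb R)$, so that $(e^{\frac{i}{\hbar}p\hat X}\psi)(x)=e^{\frac{i}{\hbar}px}\psi(x)$. Define the position-dephasing channel $$\Delta_g(\rho)=\int_{\mathbb R} e^{\frac{i}{\hbar}p\hat X}\,\rho\,e^{-\frac{i}{\hbar}p\hat X}\,d\mu(p)$$ (strong operator integral), and the dephasing function $g(\xi)=\int_{\mathbb R}e^{\frac{i}{\hbar}p\xi}\,d\mu(p)$. A state is a positive trace-class operator on $L^2(\mathbb R)$ of trace $1$; a pure state is an operator $|\psi\rangle\langle\psi|$ with $\psi\in L^2(\mathbb R)$, $\|\psi\|=1$. Let $$\mathcal I_{\mathrm{img}}^g=\{\rho \text{ a state}:\ \text{there is a state } \sigma \text{ with } \rho=\Delta_g(\sigma)\}.$$ **Proposition.** Assume $0<|g(\xi)|<1$ for almost every $\xi\neq 0$. Then no pure state belongs to $\mathcal I_{\mathrm{img}}^g$. -/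

import Mathlib

open MeasureTheory Filter Topology
open scoped ENNReal InnerProductSpace

noncomputable section

namespace PositionDephasing

/-- The Hilbert space `L²(ℝ)` of a particle on the line. -/
abbrev H : Type := Lp ℂ 2 (volume : Measure ℝ)

/-- The phase `x ↦ exp (i p x / ħ)`. -/
def phase (hbar p x : ℝ) : ℂ := Complex.exp (Complex.I * ((p * x / hbar : ℝ) : ℂ))

lemma norm_phase (hbar p x : ℝ) : ‖phase hbar p x‖ = 1 := by
  unfold phase
  rw [mul_comm]
  exact Complex.norm_exp_ofReal_mul_I _

lemma continuous_phase (hbar p : ℝ) : Continuous (phase hbar p) := by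
  unfold phase
  fun_prop

lemma continuous_phase_left (hbar x : ℝ) : Continuous (fun p => phase hbar p x) := by
  unfold phase
  fun_prop

lemma memLp_phase_mul (hbar p : ℝ) (f : H) :
    MemLp (fun x => phase hbar p x * f x) 2 (volume : Measure ℝ) := by
  refine (Lp.memLp f).of_le ((continuous_phase hbar p).aestronglyMeasurable.mul
    (Lp.memLp f).aestronglyMeasurable) (Eventually.of_forall fun x => ?_)
  simp [norm_phase]

/-- The vector `exp (i p X / ħ) f`, where `X` is the position operator: the function
`x ↦ exp (i p x / ħ) f x`. -/
def kickVec (hbar p : ℝ) (f : H) : H := (memLp_phase_mul hbar p f).toLp _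

lemma coeFn_kickVec (hbar p : ℝ) (f : H) :
    ∀ᵐ x : ℝ, kickVec hbar p f x = phase hbar p x * f x :=
  (memLp_phase_mul hbar p f).coeFn_toLp

lemma norm_kickVec (hbar p : ℝ) (f : H) : ‖kickVec hbar p f‖ = ‖f‖ := by
  rw [Lp.norm_def, Lp.norm_def]
  congr 1
  refine eLpNorm_congr_norm_ae ?_
  filter_upwards [coeFn_kickVec hbar p f] with x hx
  rw [hx, norm_mul, norm_phase, one_mul]

/-- The momentum kick `exp (i p X / ħ)`, as an operator on `L²(ℝ)`. -/
def kick (hbar p : ℝ) : H →L[ℂ] H :=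
  LinearMap.mkContinuous
    { toFun := kickVec hbar p
      map_add' := fun f h => by
        ext1
        filter_upwards [coeFn_kickVec hbar p (f + h), coeFn_kickVec hbar p f,
          coeFn_kickVec hbar p h, Lp.coeFn_add f h,
          Lp.coeFn_add (kickVec hbar p f) (kickVec hbar p h)] with x h1 h2 h3 h4 h5
        rw [h1, h5, h4, Pi.add_apply, Pi.add_apply, h2, h3, mul_add]
      map_smul' := fun c f => by
        ext1
        filter_upwards [coeFn_kickVec hbar p (c • f), coeFn_kickVec hbar p f,
          Lp.coeFn_smul c f, Lp.coeFn_smul c (kickVec hbar p f)] with x h1 h2 h3 h4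
        simp only [RingHom.id_apply]
        rw [h1, h4, h3, Pi.smul_apply, Pi.smul_apply, h2, smul_eq_mul, smul_eq_mul]
        ring }
    1 (fun f => by
        rw [one_mul]
        exact (norm_kickVec hbar p f).le)

lemma kick_apply (hbar p : ℝ) (f : H) : kick hbar p f = kickVec hbar p f := rfl

lemma norm_kick_apply (hbar p : ℝ) (f : H) : ‖kick hbar p f‖ = ‖f‖ := norm_kickVec hbar p f

lemma continuous_kick_apply (hbar : ℝ) (f : H) : Continuous (fun p => kick hbar p f) := by
  rw [continuous_iff_continuousAt]
  intro q
  unfold ContinuousAt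
  rw [Lp.tendsto_Lp_iff_tendsto_eLpNorm']
  have key : Tendsto (fun p : ℝ => ∫⁻ x : ℝ, ‖phase hbar p x * f x - phase hbar q x * f x‖ₑ ^ (2 : ℝ))
      (𝓝 q) (𝓝 (∫⁻ _ : ℝ, 0)) := by
    have hb : ∫⁻ x : ℝ, (2 * ‖f x‖ₑ) ^ (2 : ℝ) ≠ ∞ := by
      have h := (Lp.memLp f).eLpNorm_lt_top
      rw [eLpNorm_lt_top_iff_lintegral_rpow_enorm_lt_top (by norm_num) (by norm_num)] at h
      simp only [ENNReal.toReal_ofNat] at h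
      simp_rw [ENNReal.mul_rpow_of_nonneg _ _ (by norm_num : (0 : ℝ) ≤ 2)]
      rw [lintegral_const_mul' _ _ (by simp)]
      exact ENNReal.mul_ne_top (by simp) h.ne
    refine tendsto_lintegral_filter_of_dominated_convergence'
      (fun x : ℝ => (2 * ‖f x‖ₑ) ^ (2 : ℝ)) ?_ ?_ hb ?_
    · refine Eventually.of_forall fun p => ?_
      exact (((continuous_phase hbar p).aestronglyMeasurable.mul
        (Lp.memLp f).aestronglyMeasurable).sub ((continuous_phase hbar q).aestronglyMeasurable.mul
        (Lp.memLp f).aestronglyMeasurable)).enorm.pow_const _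
    · refine Eventually.of_forall fun p => Eventually.of_forall fun x => ?_
      refine ENNReal.rpow_le_rpow ?_ (by norm_num)
      refine (enorm_sub_le).trans ?_
      simp only [enorm_mul]
      have h1 : ∀ r : ℝ, ‖phase hbar r x‖ₑ = 1 := fun r => by
        rw [← ofReal_norm, norm_phase, ENNReal.ofReal_one]
      rw [h1, h1, one_mul, two_mul]
    · refine Eventually.of_forall fun x => ?_
      have hc : Continuous fun p : ℝ => ‖phase hbar p x * f x - phase hbar q x * f x‖ₑ ^ (2 : ℝ) := by
        have := continuous_phase_left hbar x
        exact (ENNReal.continuous_rpow_const).comp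
          (((this.mul continuous_const).sub continuous_const).enorm)
      have := hc.tendsto q
      simpa using this
  rw [lintegral_zero] at key
  have key2 := (ENNReal.continuous_rpow_const (y := 1 / (2 : ℝ))).tendsto 0 |>.comp key
  rw [ENNReal.zero_rpow_of_pos (by norm_num)] at key2
  refine key2.congr fun p => ?_
  rw [eLpNorm_eq_lintegral_rpow_enorm_toReal (by norm_num) (by norm_num)]
  simp only [ENNReal.toReal_ofNat, Function.comp_apply]
  congr 1
  refine lintegral_congr_ae ?_
  filter_upwards [coeFn_kickVec hbar p f, coeFn_kickVec hbar q f] with x h1 h2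
  simp only [kick_apply, Pi.sub_apply]
  rw [h1, h2]

lemma continuous_kick_conj (hbar : ℝ) (ρ : H →L[ℂ] H) (f : H) :
    Continuous (fun p => kick hbar p (ρ (kick hbar (-p) f))) := by
  have hv : Continuous fun p => ρ (kick hbar (-p) f) :=
    ρ.continuous.comp ((continuous_kick_apply hbar f).comp continuous_neg)
  rw [continuous_iff_continuousAt]
  intro q
  have h1 : Tendsto (fun p => kick hbar p (ρ (kick hbar (-p) f) - ρ (kick hbar (-q) f)))
      (𝓝 q) (𝓝 0) := by
    rw [tendsto_zero_iff_norm_tendsto_zero]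
    simp_rw [norm_kick_apply]
    have := (hv.sub (continuous_const (y := ρ (kick hbar (-q) f)))).norm.tendsto q
    simpa using this
  have h2 := h1.add ((continuous_kick_apply hbar (ρ (kick hbar (-q) f))).tendsto q)
  rw [zero_add] at h2
  refine h2.congr fun p => ?_
  rw [map_sub, sub_add_cancel]

lemma norm_kick_conj_le (hbar p : ℝ) (ρ : H →L[ℂ] H) (f : H) :
    ‖kick hbar p (ρ (kick hbar (-p) f))‖ ≤ ‖ρ‖ * ‖f‖ := by
  rw [norm_kick_apply]
  refine (ρ.le_opNorm _).trans_eq ?_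
  rw [norm_kick_apply]

lemma integrable_kick_conj (hbar : ℝ) (μ : Measure ℝ) [IsProbabilityMeasure μ]
    (ρ : H →L[ℂ] H) (f : H) :
    Integrable (fun p => kick hbar p (ρ (kick hbar (-p) f))) μ :=
  (integrable_const (‖ρ‖ * ‖f‖)).mono' (continuous_kick_conj hbar ρ f).aestronglyMeasurable
    (Eventually.of_forall fun p => norm_kick_conj_le hbar p ρ f)

/-- The random-momentum-kick dephasing channel
`Δ_g(ρ) = ∫ exp (i p X / ħ) ρ exp (-i p X / ħ) dμ(p)`, where `μ` is the law of the kick. The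
integral is taken in the strong operator sense, on each vector of `L²(ℝ)`. -/
def dephasing (hbar : ℝ) (μ : Measure ℝ) [IsProbabilityMeasure μ] (ρ : H →L[ℂ] H) : H →L[ℂ] H :=
  LinearMap.mkContinuous
    { toFun := fun f => ∫ p, kick hbar p (ρ (kick hbar (-p) f)) ∂μ
      map_add' := fun f h => by
        simp only [map_add]
        exact integral_add (integrable_kick_conj hbar μ ρ f) (integrable_kick_conj hbar μ ρ h)
      map_smul' := fun c f => by
        simp only [map_smul, RingHom.id_apply]
        exact integral_smul c _ }
    ‖ρ‖ (fun f => by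
      refine (norm_integral_le_of_norm_le_const
        (Eventually.of_forall fun p => norm_kick_conj_le hbar p ρ f)).trans_eq ?_
      simp)

/-- The dephasing function `g(ξ) = ∫ exp (i p ξ / ħ) dμ(p)`, the characteristic function of the
law `μ` of the momentum kick. -/
def dephasingFunction (hbar : ℝ) (μ : Measure ℝ) (ξ : ℝ) : ℂ := ∫ p, phase hbar p ξ ∂μ

/-- A state (density operator) on `L²(ℝ)`: a positive trace-class operator of trace one. A positive
operator is trace class with trace `t` exactly if its diagonal entries in an orthonormal basis
sum to `t`; neither the summability nor the sum depends on the basis. -/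
structure IsState (ρ : H →L[ℂ] H) : Prop where
  isPositive : ρ.IsPositive
  trace_eq_one : ∀ {ι : Type} (b : HilbertBasis ι ℂ H), HasSum (fun i => ⟪b i, ρ (b i)⟫_ℂ) 1

/-- A pure state `|ψ⟩⟨ψ|`, with `ψ` a unit vector of `L²(ℝ)`. -/
def IsPureState (ρ : H →L[ℂ] H) : Prop :=
  ∃ ψ : H, ‖ψ‖ = 1 ∧ ρ = InnerProductSpace.rankOne ℂ ψ ψ

/-- The image-incoherent states: the states `ρ = Δ_g(σ)` for some state `σ`. -/
def imageIncoherent (hbar : ℝ) (μ : Measure ℝ) [IsProbabilityMeasure μ] : Set (H →L[ℂ] H) :=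
  {ρ | IsState ρ ∧ ∃ σ : H →L[ℂ] H, IsState σ ∧ ρ = dephasing hbar μ σ}

end PositionDephasing

end

/-! The quadratic form of `|ψ⟩⟨ψ|` vanishes on the orthogonal complement of `ψ`. If `|ψ⟩⟨ψ|` is the
average `Δ_g(σ)` of the positive operators `U_p σ U_p*`, where `U_p = exp (i p X / ħ)`, then by
positivity and continuity in `p` each of these with `p` in the support of `μ` annihilates that
complement, hence has range in the line spanned by `ψ`. So `U_p φ` lies on that line for a nonzero
`φ` in the range of `σ` and every `p` in the support. Two distinct such `p`, `q` would make `φ` an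
eigenvector of `U_{p-q}`, a multiplication operator whose symbol has null level sets. Hence `μ` is a
point mass, whose dephasing function has modulus one everywhere. -/

namespace PositionDephasing

variable {𝕜 E : Type*} [RCLike 𝕜] [NormedAddCommGroup E] [InnerProductSpace 𝕜 E]

section PositiveOperators

lemma norm_inner_apply_sq_le {T : E →ₗ[𝕜] E} (hT : T.IsPositive) (x y : E) :
    ‖⟪T x, y⟫_𝕜‖ ^ 2 ≤ RCLike.re ⟪T x, x⟫_𝕜 * RCLike.re ⟪T y, y⟫_𝕜 := by
  let form : PreInnerProductSpace.Core 𝕜 E :=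
    { inner := fun u v => ⟪T u, v⟫_𝕜
      conj_inner_symm := fun u v => by rw [inner_conj_symm, hT.isSymmetric]
      re_inner_nonneg := hT.re_inner_nonneg_left
      add_left := fun u v w => by rw [map_add, inner_add_left]
      smul_left := fun u v c => by rw [map_smul, inner_smul_left] }
  have hsymm : ‖⟪T y, x⟫_𝕜‖ = ‖⟪T x, y⟫_𝕜‖ := by rw [hT.isSymmetric, norm_inner_symm]
  calc ‖⟪T x, y⟫_𝕜‖ ^ 2 = ‖⟪T x, y⟫_𝕜‖ * ‖⟪T y, x⟫_𝕜‖ := by rw [hsymm, sq]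
    _ ≤ RCLike.re ⟪T x, x⟫_𝕜 * RCLike.re ⟪T y, y⟫_𝕜 :=
      @InnerProductSpace.Core.inner_mul_inner_self_le 𝕜 E _ _ _ form x y

lemma re_inner_apply_self_eq_zero_iff {T : E →ₗ[𝕜] E} (hT : T.IsPositive) {x : E} :
    RCLike.re ⟪T x, x⟫_𝕜 = 0 ↔ T x = 0 := by
  refine ⟨fun hx => ?_, fun hx => by rw [hx, inner_zero_left, map_zero]⟩
  have hsq : ‖⟪T x, T x⟫_𝕜‖ ^ 2 ≤ 0 := by
    simpa only [hx, zero_mul] using norm_inner_apply_sq_le hT x (T x)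
  exact inner_self_eq_zero.mp (norm_eq_zero.mp (pow_eq_zero_iff two_ne_zero |>.mp
    (hsq.antisymm (sq_nonneg _))))

lemma range_le_of_orthogonal_le_ker {T : E →ₗ[𝕜] E} (hT : T.IsSymmetric) {K : Submodule 𝕜 E}
    [K.HasOrthogonalProjection] (hK : Kᗮ ≤ T.ker) : T.range ≤ K :=
  calc T.range ≤ T.rangeᗮᗮ := T.range.le_orthogonal_orthogonal
    _ = T.kerᗮ := by rw [hT.orthogonal_range]
    _ ≤ Kᗮᗮ := Submodule.orthogonal_le hK
    _ = K := K.orthogonal_orthogonal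

end PositiveOperators

section Support

variable {X : Type*} [TopologicalSpace X] [MeasurableSpace X] {μ : Measure X}

lemma eqOn_support_zero_of_integral_eq_zero {φ : X → ℝ} (hcont : Continuous φ) (hφ : 0 ≤ φ)
    (hint : Integrable φ μ) (h : ∫ p, φ p ∂μ = 0) : Set.EqOn φ 0 μ.support :=
  Measure.support_subset_of_isClosed (isClosed_eq hcont continuous_const)
    ((integral_eq_zero_iff_of_nonneg hφ hint).mp h)

lemma apply_eq_zero_of_inner_integral_apply_eq_zero [NormedSpace ℝ E] [CompleteSpace E]
    {A : X → E →ₗ[𝕜] E} (hA : ∀ p, (A p).IsPositive) {f : E} (hcont : Continuous fun p => A p f)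
    (hint : Integrable (fun p => A p f) μ) (h : ⟪f, ∫ p, A p f ∂μ⟫_𝕜 = 0) {p : X}
    (hp : p ∈ μ.support) : A p f = 0 := by
  have hform : Integrable (fun p => ⟪f, A p f⟫_𝕜) μ := hint.const_inner f
  have hzero : ∫ p, RCLike.re ⟪f, A p f⟫_𝕜 ∂μ = 0 := by
    rw [integral_re hform, integral_inner hint, h, map_zero]
  have hre : RCLike.re ⟪f, A p f⟫_𝕜 = 0 :=
    eqOn_support_zero_of_integral_eq_zero
      (RCLike.continuous_re.comp (continuous_const.inner hcont))
      (fun p => (hA p).re_inner_nonneg_right f) hform.re hzero hp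
  rwa [inner_re_symm, re_inner_apply_self_eq_zero_iff (hA p)] at hre

lemma exists_eq_dirac_of_support_subsingleton [HereditarilyLindelofSpace X]
    [IsProbabilityMeasure μ] (h : μ.support.Subsingleton) : ∃ p, μ = Measure.dirac p := by
  obtain ⟨p, hp⟩ := Measure.nonempty_support (IsProbabilityMeasure.ne_zero μ)
  have hconst : id =ᵐ[μ] fun _ => p := by
    filter_upwards [Measure.support_mem_ae (μ := μ)] with q hq using h hq hp
  refine ⟨p, ?_⟩
  calc μ = μ.map id := Measure.map_id.symm
    _ = μ.map fun _ => p := Measure.map_congr hconst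
    _ = Measure.dirac p := by rw [Measure.map_const, measure_univ, one_smul]

end Support

section Kick

variable (hbar : ℝ)

lemma phase_add (p q x : ℝ) : phase hbar (p + q) x = phase hbar p x * phase hbar q x := by
  simp only [phase, ← Complex.exp_add]
  push_cast
  ring_nf

lemma phase_zero (x : ℝ) : phase hbar 0 x = 1 := by
  simp [phase]

lemma conj_phase (p x : ℝ) : starRingEnd ℂ (phase hbar p x) = phase hbar (-p) x := by
  simp [phase, ← Complex.exp_conj, neg_div]

lemma kick_kick (p q : ℝ) (f : H) : kick hbar p (kick hbar q f) = kick hbar (p + q) f := by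
  simp only [kick_apply]
  ext1
  filter_upwards [coeFn_kickVec hbar p (kickVec hbar q f), coeFn_kickVec hbar q f,
    coeFn_kickVec hbar (p + q) f] with x hpq hq hadd
  rw [hpq, hq, hadd, phase_add, mul_assoc]

lemma kick_zero (f : H) : kick hbar 0 f = f := by
  rw [kick_apply]
  ext1
  filter_upwards [coeFn_kickVec hbar 0 f] with x hx
  rw [hx, phase_zero, one_mul]

lemma kick_neg_kick (p : ℝ) (f : H) : kick hbar (-p) (kick hbar p f) = f := by
  rw [kick_kick, neg_add_cancel, kick_zero]

lemma adjoint_kick (p : ℝ) : (kick hbar p).adjoint = kick hbar (-p) := by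
  refine ((ContinuousLinearMap.eq_adjoint_iff _ _).mpr fun f h => ?_).symm
  rw [L2.inner_def, L2.inner_def]
  refine integral_congr_ae ?_
  filter_upwards [coeFn_kickVec hbar p h, coeFn_kickVec hbar (-p) f] with x hx hx'
  simp only [kick_apply, hx, hx', RCLike.inner_apply, map_mul, conj_phase, neg_neg]
  ring

variable {hbar}

lemma countable_setOf_phase_eq (hbar_ne : hbar ≠ 0) {p : ℝ} (hp : p ≠ 0) (c : ℂ) :
    {x : ℝ | phase hbar p x = c}.Countable := by
  have hinj : Function.Injective fun x : ℝ => Complex.I * ((p * x / hbar : ℝ) : ℂ) := by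
    intro x y hxy
    simpa [hbar_ne, hp, Complex.I_ne_zero, div_left_inj'] using hxy
  exact (Set.countable_singleton c).preimage_cexp.preimage_of_injOn hinj.injOn

lemma eq_zero_of_kick_eq_smul (hbar_ne : hbar ≠ 0) {p : ℝ} (hp : p ≠ 0) {c : ℂ} {f : H}
    (h : kick hbar p f = c • f) : f = 0 := by
  have hc : ∀ᵐ x : ℝ, phase hbar p x ≠ c :=
    measure_eq_zero_iff_ae_notMem.mp ((countable_setOf_phase_eq hbar_ne hp c).measure_zero volume)
  rw [kick_apply] at h
  ext1
  filter_upwards [hc, coeFn_kickVec hbar p f, Lp.coeFn_smul c f, Lp.coeFn_zero ℂ 2 volume]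
    with x hx hkick hsmul hzero
  rw [h, hsmul, Pi.smul_apply, smul_eq_mul] at hkick
  rw [hzero, Pi.zero_apply]
  exact (mul_eq_mul_right_iff.mp hkick).resolve_left hx.symm

lemma eq_of_kick_mem_span_singleton (hbar_ne : hbar ≠ 0) {f ψ : H} (hf : f ≠ 0) {p q : ℝ}
    (hp : kick hbar p f ∈ ℂ ∙ ψ) (hq : kick hbar q f ∈ ℂ ∙ ψ) : p = q := by
  obtain ⟨a, ha⟩ := Submodule.mem_span_singleton.mp hp
  obtain ⟨b, hb⟩ := Submodule.mem_span_singleton.mp hq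
  have hb0 : b ≠ 0 := by
    rintro rfl
    rw [zero_smul] at hb
    exact hf (by rw [← kick_neg_kick hbar q f, ← hb, map_zero])
  have hparallel : kick hbar p f = (a * b⁻¹) • kick hbar q f := by
    rw [← hb, mul_smul, inv_smul_smul₀ hb0, ha]
  have heigen : kick hbar (p - q) f = (a * b⁻¹) • f := by
    rw [sub_eq_neg_add, ← kick_kick, hparallel, map_smul, kick_neg_kick]
  by_contra hpq
  exact hf (eq_zero_of_kick_eq_smul hbar_ne (sub_ne_zero.mpr hpq) heigen)

end Kick

section Dephasing

/-- The operator `exp (i p X / ħ) σ exp (-i p X / ħ)`: the state into which a momentum kick `p`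
turns `σ`, and the integrand of `dephasing`. -/
noncomputable def kickConj (hbar p : ℝ) (σ : H →L[ℂ] H) : H →L[ℂ] H :=
  kick hbar p ∘L σ ∘L kick hbar (-p)

variable {hbar : ℝ} {μ : Measure ℝ} [IsProbabilityMeasure μ] {σ : H →L[ℂ] H}

lemma kickConj_kick (p : ℝ) (f : H) :
    kickConj hbar p σ (kick hbar p f) = kick hbar p (σ f) :=
  congrArg (fun h => kick hbar p (σ h)) (kick_neg_kick hbar p f)

lemma isPositive_kickConj (hσ : σ.IsPositive) (p : ℝ) : (kickConj hbar p σ).IsPositive := by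
  simpa only [kickConj, adjoint_kick] using hσ.conj_adjoint (kick hbar p)

lemma dephasing_apply (f : H) :
    dephasing hbar μ σ f = ∫ p, kickConj hbar p σ f ∂μ :=
  rfl

lemma dephasing_zero : dephasing hbar μ 0 = 0 := by
  ext1 f
  simp [dephasing_apply, kickConj]

lemma kickConj_apply_eq_zero_of_inner_dephasing_eq_zero (hσ : σ.IsPositive) {f : H}
    (hf : ⟪f, dephasing hbar μ σ f⟫_ℂ = 0) {p : ℝ} (hp : p ∈ μ.support) :
    kickConj hbar p σ f = 0 :=
  apply_eq_zero_of_inner_integral_apply_eq_zero (A := fun p => (kickConj hbar p σ : H →ₗ[ℂ] H))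
    (fun p => (isPositive_kickConj hσ p).toLinearMap) (continuous_kick_conj hbar σ f)
    (integrable_kick_conj hbar μ σ f) hf hp

lemma kickConj_apply_mem_span_singleton (hσ : σ.IsPositive) {ψ : H}
    (h : dephasing hbar μ σ = InnerProductSpace.rankOne ℂ ψ ψ) {p : ℝ} (hp : p ∈ μ.support)
    (f : H) : kickConj hbar p σ f ∈ ℂ ∙ ψ := by
  have hker : (ℂ ∙ ψ)ᗮ ≤ (kickConj hbar p σ : H →ₗ[ℂ] H).ker := by
    intro w hw
    refine kickConj_apply_eq_zero_of_inner_dephasing_eq_zero hσ ?_ hp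
    rw [h, InnerProductSpace.rankOne_apply, inner_smul_right,
      Submodule.mem_orthogonal_singleton_iff_inner_left.mp hw, mul_zero]
  exact range_le_of_orthogonal_le_ker (isPositive_kickConj hσ p).isSymmetric hker ⟨f, rfl⟩

lemma exists_eq_dirac_of_dephasing_eq_rankOne (hbar_ne : hbar ≠ 0) (hσ : σ.IsPositive) {ψ : H}
    (hψ : ψ ≠ 0) (h : dephasing hbar μ σ = InnerProductSpace.rankOne ℂ ψ ψ) :
    ∃ p, μ = Measure.dirac p := by
  have hσ0 : σ ≠ 0 := by
    rintro rfl
    exact InnerProductSpace.rankOne_ne_zero hψ hψ (h.symm.trans dephasing_zero)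
  obtain ⟨f, hf⟩ := DFunLike.ne_iff.mp hσ0
  have hspan : ∀ p ∈ μ.support, kick hbar p (σ f) ∈ ℂ ∙ ψ := fun p hp => by
    rw [← kickConj_kick]
    exact kickConj_apply_mem_span_singleton hσ h hp _
  exact exists_eq_dirac_of_support_subsingleton fun p hp q hq =>
    eq_of_kick_mem_span_singleton hbar_ne hf (hspan p hp) (hspan q hq)

lemma norm_dephasingFunction_dirac (p ξ : ℝ) :
    ‖dephasingFunction hbar (Measure.dirac p) ξ‖ = 1 := by
  rw [dephasingFunction, integral_dirac, norm_phase]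

end Dephasing

end PositionDephasing

theorem mainTheorem11_general {hbar : ℝ} (hbar_ne : hbar ≠ 0) {μ : Measure ℝ}
    [IsProbabilityMeasure μ] {ξ : ℝ} (hξ : ‖PositionDephasing.dephasingFunction hbar μ ξ‖ ≠ 1)
    {σ : PositionDephasing.H →L[ℂ] PositionDephasing.H} (hσ : σ.IsPositive) :
    ¬ PositionDephasing.IsPureState (PositionDephasing.dephasing hbar μ σ) := by
  rintro ⟨ψ, hψ, h⟩
  have hψ0 : ψ ≠ 0 := norm_ne_zero_iff.mp (hψ ▸ one_ne_zero)
  obtain ⟨p, rfl⟩ :=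
    PositionDephasing.exists_eq_dirac_of_dephasing_eq_rankOne hbar_ne hσ hψ0 h
  exact hξ (PositionDephasing.norm_dephasingFunction_dirac p ξ)

theorem mainTheorem11 (hbar : ℝ) (hbar_pos : 0 < hbar)
    (μ : MeasureTheory.Measure ℝ) [MeasureTheory.IsProbabilityMeasure μ]
    (hg : ∀ᵐ ξ : ℝ ∂MeasureTheory.volume, ξ ≠ 0 →
      0 < ‖PositionDephasing.dephasingFunction hbar μ ξ‖ ∧
        ‖PositionDephasing.dephasingFunction hbar μ ξ‖ < 1) :
    ∀ ρ : PositionDephasing.H →L[ℂ] PositionDephasing.H,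
      PositionDephasing.IsPureState ρ → ρ ∉ PositionDephasing.imageIncoherent hbar μ := by
  rintro _ hρ ⟨-, σ, hσ, rfl⟩
  obtain ⟨ξ, hξ, hξ0⟩ := (hg.and (Measure.ae_ne volume 0)).exists
  exact mainTheorem11_general hbar_pos.ne' (hξ hξ0).2.ne hσ.isPositive hρ
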